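/- Let $g:[0,\infty)\to[0,1]$ be non-increasing with $g(x)=o\left(\frac{1}{x^{2}\log^{2}x}\right)$ as $x\to\infty$, and suppose that $C:=\int_{\mathbb{R}^2}g(\|\boldsymbol{x}\|)\,d\boldsymbol{x}>0$ ($C<\infty$ then holds automatically). Let $b=b(\rho)$ be a real-valued function of $\rho$ (not necessarily constant) such that $\log\rho+b(\rho)>0$ for all sufficiently large $\rho$. For such $\rho$ put $$r_\rho=\sqrt{\frac{\log\rho+b}{C\rho}},\qquad A_{1/r_\rho}=\left[-\tfrac{1}{2r_\rho},\tfrac{1}{2r_\rho}\right]^2,$$ and let $\mathcal{G}\left(\mathcal{X}_{\frac{\log\rho+b}{C}},g,A_{1/r_\rho}\right)$ be the random graph whose vertices form a homogeneous Poisson point process of density $\frac{\log\rho+b}{C}$ on $A_{1/r_\rho}$ and in which each pair of vertices at Euclidean distance $x$ is joined by an edge with probability $g(x)$, independently for distinct pairs. If this graph is connected with probability tending to $1$ as $\rho\to\infty$, then $b(\rho)\to\infty$ as $\rho\to\infty$. -/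

import Mathlib

open MeasureTheory ProbabilityTheory Filter Topology Asymptotics

noncomputable section

namespace RandomConnection

/-- The Euclidean plane (`ℝ²` with the Euclidean norm and Lebesgue measure). -/
abbrev Plane : Type := EuclideanSpace ℝ (Fin 2)

/-- A sample of the random data of a finite random connection model: the number of nodes, a sequence
of candidate node positions (the nodes are the first ones in the sequence), and a mark in `[0,1]`
for each unordered pair of labels. -/
abbrev Sample : Type := ℕ × (ℕ → Plane) × (Sym2 ℕ → unitInterval)

/-- The law of the data of a random connection model whose nodes form a homogeneous Poisson point
process with density `lam` on a region `A` of positive finite area. The number of nodes is Poisson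
distributed with mean `lam * area(A)`, the positions are independent and uniformly distributed on
`A`, the marks are independent and uniformly distributed on `[0,1]`, and the number of nodes, the
positions and the marks are independent of each other. -/
def sampleLaw (lam : ℝ) (A : Set Plane) : Measure Sample :=
  (poissonMeasure (lam * volume.real A).toNNReal).prod
    ((Measure.infinitePi fun _ : ℕ => (volume : Measure Plane)[|A]).prod
      (Measure.infinitePi fun _ : Sym2 ℕ => (volume : Measure unitInterval)))

/-- The random graph with connection function `g`: two distinct nodes at positions `x`, `y` are
adjacent iff the mark of the pair is at most `g ‖x - y‖`, which has probability `g ‖x - y‖`,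
independently over distinct pairs. -/
def graph (g : ℝ → ℝ) (ω : Sample) : SimpleGraph (Fin ω.1) where
  Adj i j := i ≠ j ∧ (ω.2.2 s((i : ℕ), (j : ℕ)) : ℝ) ≤ g (dist (ω.2.1 i) (ω.2.1 j))
  symm := ⟨fun i j h => ⟨h.1.symm, by rw [Sym2.eq_swap, dist_comm]; exact h.2⟩⟩
  loopless := ⟨fun _ h => h.1 rfl⟩

/-- The constant `C = ∫_{ℝ²} g(‖x‖) dx`. -/
def connConst (g : ℝ → ℝ) : ℝ := ∫ x : Plane, g ‖x‖

/-- `r_ρ = √((log ρ + b) / (C ρ))`. -/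
def connRadius (g : ℝ → ℝ) (b ρ : ℝ) : ℝ := √((Real.log ρ + b) / (connConst g * ρ))

/-- The node density `(log ρ + b) / C`. -/
def nodeDensity (g : ℝ → ℝ) (b ρ : ℝ) : ℝ := (Real.log ρ + b) / connConst g

/-- The square `[-s/2, s/2]²` with side length `s`. -/
def square (s : ℝ) : Set Plane := {x | ∀ i, x i ∈ Set.Icc (-(s / 2)) (s / 2)}

/-- The probability that the network with Poisson distributed nodes of density `(log ρ + b) / C` on
the square `[-1/(2 r_ρ), 1/(2 r_ρ)]²` and with connection function `g` is connected. -/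
def probConnected (g : ℝ → ℝ) (b ρ : ℝ) : ENNReal :=
  sampleLaw (nodeDensity g b ρ) (square (1 / connRadius g b ρ)) {ω | (graph g ω).Connected}

end RandomConnection

end

/-! ### Product measures and Poisson factorial moments. -/

namespace RandomConnection

open scoped ENNReal NNReal Nat

/-! The proof is by contraposition: if `b ρ < B` for arbitrarily large `ρ`, then at those `ρ` an
isolated node exists with probability bounded away from `0`, so connectivity cannot have probability
tending to `1`.

Let `N` count the isolated nodes in a square `D` slightly smaller than the domain, and let `u = log
ρ + b`. The number of nodes is Poisson with mean `ρ`, and a node at `x` is isolated with probability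
at least `exp (-u)`, since truncating the plane to the square only removes neighbours. Hence `E N ≥
ρ exp (-u) / 4 = exp (-b) / 4`.

The second factorial moment is split at distance `R = log ρ` (`isolatedMean₂_le`). For far pairs the
two neighbourhoods overlap so little that the joint isolation probability is at most twice the
product. For near pairs that may be non-adjacent, `exists_private_disc` gives a disc of fixed size
seen by one node and often missed by the other, which costs a further factor `exp (-κ u)`; there are
only about `u log² ρ` candidates for the second node. Altogether `E[N(N-1)] ≤ 2 (E N)² + Q E N` with
`1 + Q ≤ M E N` for a constant `M` depending on `B` only, and the second moment method
(`le_prob_existsIsolated`) gives `P(N > 0) ≥ 1 / (2 + M)`. A bounded factor suffices because only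
positivity of the limiting probability is at stake.

A connected graph has an isolated node only if it has a single node, an event of probability `ρ exp
(-ρ)`. The bound at fixed density is `sampleLaw_connected_le`; the limit is taken in
`tendsto_atTop_of_antitone`. -/

theorem measurable_prod_coordinates {ι α : Type*} [MeasurableSpace α] {f : α → ℝ≥0∞} (hf : Measurable f)
    (s : Finset ι) :
    Measurable fun X : ι → α => ∏ j ∈ s, f (X j) := by
  fun_prop

section ProductMeasure

variable {ι α : Type*} [DecidableEq ι] [MeasurableSpace α]

theorem measurable_update_prod (i : ι) :
    Measurable fun p : α × (ι → α) => Function.update p.2 i p.1 := by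
  refine measurable_pi_lambda _ fun j => ?_
  by_cases hj : j = i
  · subst hj; simpa using measurable_fst
  · simpa [Function.update_of_ne hj, Function.comp_def] using
      (measurable_pi_apply j).comp (measurable_snd (α := α) (β := ι → α))

/-- Resampling one coordinate of an i.i.d. family does not change its law. -/
theorem map_update_infinitePi (ν : Measure α) [IsProbabilityMeasure ν] (i : ι) :
    (ν.prod (Measure.infinitePi fun _ : ι => ν)).map (fun p => Function.update p.2 i p.1) =
      Measure.infinitePi fun _ : ι => ν := by
  refine Measure.eq_infinitePi _ fun s t ht => ?_
  rw [Measure.map_apply (measurable_update_prod i) (MeasurableSet.pi s.countable_toSet fun j _ => ht j)]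
  have hpre : (fun p : α × (ι → α) => Function.update p.2 i p.1) ⁻¹' (Set.pi s t) =
      (if i ∈ s then t i else Set.univ) ×ˢ Set.pi (s.erase i : Finset ι) t := by
    ext ⟨x, X⟩
    simp only [Set.mem_preimage, Set.mem_pi, Finset.mem_coe, Set.mem_prod, Finset.mem_erase]
    constructor
    · intro h
      refine ⟨?_, fun j hj => by simpa [Function.update_of_ne hj.1] using h j hj.2⟩
      split_ifs with his
      · simpa using h i his
      · trivial
    · rintro ⟨h1, h2⟩ j hj
      by_cases hji : j = i
      · subst hji; simpa [hj] using h1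
      · simpa [Function.update_of_ne hji] using h2 j ⟨hji, hj⟩
  rw [hpre, Measure.prod_prod, Measure.infinitePi_pi _ fun j _ => ht j]
  split_ifs with his
  · exact Finset.mul_prod_erase s (fun j => ν (t j)) his
  · simp [Finset.erase_eq_of_notMem his]

/-- A form of Fubini that isolates one coordinate without splitting the index set; it is used to
condition on the position of a chosen node. -/
theorem lintegral_infinitePi_update (ν : Measure α) [IsProbabilityMeasure ν] (i : ι)
    {F : (ι → α) → ℝ≥0∞} (hF : Measurable F) :
    ∫⁻ X, F X ∂(Measure.infinitePi fun _ : ι => ν) =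
      ∫⁻ x, ∫⁻ X, F (Function.update X i x) ∂(Measure.infinitePi fun _ : ι => ν) ∂ν := by
  conv_lhs => rw [← map_update_infinitePi ν i]
  rw [lintegral_map hF (measurable_update_prod i),
    lintegral_prod (fun p : α × (ι → α) => F (Function.update p.2 i p.1))
      (hF.comp (measurable_update_prod i)).aemeasurable]

theorem lintegral_infinitePi_prod (ν : Measure α) [IsProbabilityMeasure ν] {f : α → ℝ≥0∞}
    (hf : Measurable f) (s : Finset ι) :
    ∫⁻ X, ∏ j ∈ s, f (X j) ∂(Measure.infinitePi fun _ : ι => ν) = (∫⁻ x, f x ∂ν) ^ s.card := by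
  induction s using Finset.induction_on with
  | empty => simp
  | insert i s his ih =>
    rw [lintegral_infinitePi_update ν i (by fun_prop), Finset.card_insert_of_notMem his, pow_succ',
      ← ih]
    have : ∀ (x : α) (X : ι → α), ∏ j ∈ insert i s, f (Function.update X i x j) =
        f x * ∏ j ∈ s, f (X j) := by
      intro x X
      rw [Finset.prod_insert his, Function.update_self]
      congr 1
      exact Finset.prod_congr rfl fun j hj => by
        rw [Function.update_of_ne (ne_of_mem_of_not_mem hj his)]
    simp_rw [this]
    rw [← lintegral_mul_const _ hf]
    refine lintegral_congr fun x => ?_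
    rw [lintegral_const_mul _ (by fun_prop)]

end ProductMeasure

theorem infinitePi_volume_forall_lt {ι : Type*} (s : Finset ι) (t : ι → ℝ)
    (ht : ∀ i, t i ∈ Set.Icc (0 : ℝ) 1) :
    Measure.infinitePi (fun _ : ι => (volume : Measure unitInterval))
      {U | ∀ i ∈ s, t i < U i} = ∏ i ∈ s, ENNReal.ofReal (1 - t i) := by
  have : {U : ι → unitInterval | ∀ i ∈ s, t i < U i} =
      Set.pi s fun i => Set.Ioi (⟨t i, ht i⟩ : unitInterval) := by
    ext U; simp [Set.pi, ← Subtype.coe_lt_coe]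
  rw [this, Measure.infinitePi_pi _ fun i _ => measurableSet_Ioi]
  simp [unitInterval.volume_Ioi]

/-- Factorial moments of a binomially thinned Poisson variable. -/
theorem lintegral_descFactorial_mul_pow_poissonMeasure (m : ℝ≥0) (k : ℕ) {q : ℝ≥0∞} (hq : q ≤ 1) :
    ∫⁻ n, (n.descFactorial k : ℝ≥0∞) * q ^ (n - k) ∂(poissonMeasure m) =
      ENNReal.ofReal (m ^ k * Real.exp (-(m * (1 - q.toReal)))) := by
  lift q to ℝ≥0 using ne_top_of_le_ne_top ENNReal.one_ne_top hq
  rw [lintegral_countable']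
  have hterm : ∀ n : ℕ, (n.descFactorial k : ℝ≥0∞) * (q : ℝ≥0∞) ^ (n - k) * poissonMeasure m {n} =
      ENNReal.ofReal (n.descFactorial k * q ^ (n - k) * (Real.exp (-m) * m ^ n / n !)) := by
    intro n
    rw [poissonMeasure_singleton, ENNReal.ofReal_mul (by positivity),
      ENNReal.ofReal_mul (by positivity), ENNReal.ofReal_pow (by positivity)]
    simp
  simp_rw [hterm]
  have hsum : HasSum (fun n : ℕ => (n.descFactorial k * q ^ (n - k) *
      (Real.exp (-m) * m ^ n / n !) : ℝ)) (m ^ k * Real.exp (-(m * (1 - q)))) := by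
    -- The terms with `n < k`, where `n - k` truncates, vanish because `n.descFactorial k = 0`.
    rw [← hasSum_nat_add_iff' k]
    have hzero : ∑ n ∈ Finset.range k, (n.descFactorial k * q ^ (n - k) *
        (Real.exp (-m) * m ^ n / n !) : ℝ) = 0 :=
      Finset.sum_eq_zero fun n hn => by
        rw [Nat.descFactorial_eq_zero_iff_lt.2 (Finset.mem_range.1 hn)]; simp
    rw [hzero, sub_zero]
    have hexp : HasSum (fun n : ℕ => ((m * q : ℝ) ^ n / n !)) (Real.exp (m * q)) := by
      rw [Real.exp_eq_exp_ℝ]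
      exact NormedSpace.expSeries_div_hasSum_exp (m * q : ℝ)
    have hmul := hexp.mul_left ((m : ℝ) ^ k * Real.exp (-m))
    have hval : (m : ℝ) ^ k * Real.exp (-m) * Real.exp (m * q) =
        m ^ k * Real.exp (-(m * (1 - q))) := by
      rw [mul_assoc, ← Real.exp_add]; ring_nf
    rw [hval] at hmul
    have hshift : ∀ n : ℕ, ((n + k).descFactorial k * q ^ (n + k - k) *
        (Real.exp (-m) * m ^ (n + k) / (n + k)!) : ℝ) =
          m ^ k * Real.exp (-m) * ((m * q) ^ n / n !) := by
      intro n
      have hf : ((n + k)! : ℝ) = n ! * (n + k).descFactorial k := by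
        have := Nat.factorial_mul_descFactorial (Nat.le_add_left k n)
        rw [Nat.add_sub_cancel] at this
        exact_mod_cast this.symm
      have hd : ((n + k).descFactorial k : ℝ) ≠ 0 := by
        rw [Nat.cast_ne_zero, Ne, Nat.descFactorial_eq_zero_iff_lt]; lia
      have hn : (n ! : ℝ) ≠ 0 := by positivity
      rw [hf, Nat.add_sub_cancel]
      field_simp
      ring
    simp only [hshift]
    exact hmul
  rw [← ENNReal.ofReal_tsum_of_nonneg (fun n => by positivity) hsum.summable, hsum.tsum_eq]
  simp

theorem ennreal_two_mul_le_add_sq (a b : ℝ≥0∞) : 2 * a * b ≤ a ^ 2 + b ^ 2 := by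
  by_cases ha : a = ∞
  · simp [ha]
  by_cases hb : b = ∞
  · simp [hb]
  lift a to ℝ≥0 using ha
  lift b to ℝ≥0 using hb
  exact_mod_cast two_mul_le_add_sq a b

end RandomConnection

/-! ### Isolation probabilities for a fixed number of nodes. -/

namespace RandomConnection

open scoped ENNReal NNReal

/-- The law of infinitely many candidate positions, independent with law `ν`, and of the marks. -/
noncomputable def labelLaw (ν : Measure Plane) : Measure ((ℕ → Plane) × (Sym2 ℕ → unitInterval)) :=
  (Measure.infinitePi fun _ : ℕ => ν).prod
    (Measure.infinitePi fun _ : Sym2 ℕ => (volume : Measure unitInterval))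

/-- The event that among the first `n` nodes the `i`-th one lies in `D` and is isolated. -/
noncomputable def isolatedEvent (g : ℝ → ℝ) (D : Set Plane) (n i : ℕ) :
    Set ((ℕ → Plane) × (Sym2 ℕ → unitInterval)) :=
  {p | p.1 i ∈ D ∧ ∀ j ∈ (Finset.range n).erase i, g (dist (p.1 i) (p.1 j)) < p.2 s(i, j)}

/-- The probability that nodes at `x` and `y` are not adjacent. -/
noncomputable def avoidProb (g : ℝ → ℝ) (x y : Plane) : ℝ≥0∞ := ENNReal.ofReal (1 - g (dist x y))

instance (ν : Measure Plane) [IsProbabilityMeasure ν] : IsProbabilityMeasure (labelLaw ν) := by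
  unfold labelLaw; infer_instance

section

variable {g : ℝ → ℝ}

theorem measurable_avoidProb {β : Type*} [MeasurableSpace β] (hg : Measurable g) {u v : β → Plane}
    (hu : Measurable u) (hv : Measurable v) :
    Measurable fun b => avoidProb g (u b) (v b) :=
  (measurable_const.sub (hg.comp (hu.dist hv))).ennreal_ofReal

theorem avoidProb_le_one (hg : ∀ x, g x ∈ Set.Icc (0 : ℝ) 1) (x y : Plane) :
    avoidProb g x y ≤ 1 := by
  rw [avoidProb, ENNReal.ofReal_le_one]; linarith [(hg (dist x y)).1]

theorem measurableSet_isolatedEvent (hg : Measurable g) {D : Set Plane} (hD : MeasurableSet D)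
    (n i : ℕ) : MeasurableSet (isolatedEvent g D n i) := by
  have : isolatedEvent g D n i = {p | p.1 i ∈ D} ∩ ⋂ j ∈ (Finset.range n).erase i,
      {p | g (dist (p.1 i) (p.1 j)) < p.2 s(i, j)} := by
    ext p; simp [isolatedEvent]
  rw [this]
  refine MeasurableSet.inter (((measurable_pi_apply i).comp measurable_fst) hD) ?_
  refine Finset.measurableSet_biInter _ fun j _ => measurableSet_lt ?_ ?_
  · exact hg.comp (((measurable_pi_apply i).comp measurable_fst).dist
      ((measurable_pi_apply j).comp measurable_fst))
  · exact measurable_subtype_coe.comp ((measurable_pi_apply _).comp measurable_snd)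

/-- The distance of the end points of a pair of labels. -/
noncomputable def pairDist (X : ℕ → Plane) : Sym2 ℕ → ℝ :=
  Sym2.lift ⟨fun i j => dist (X i) (X j), fun _ _ => dist_comm _ _⟩

@[simp]
theorem pairDist_mk (X : ℕ → Plane) (i j : ℕ) : pairDist X s(i, j) = dist (X i) (X j) := rfl

theorem infinitePi_volume_marks (hg : ∀ x, g x ∈ Set.Icc (0 : ℝ) 1) (X : ℕ → Plane)
    (s : Finset (Sym2 ℕ)) :
    Measure.infinitePi (fun _ : Sym2 ℕ => (volume : Measure unitInterval))
      {U | ∀ e ∈ s, g (pairDist X e) < U e} =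
        ∏ e ∈ s, ENNReal.ofReal (1 - g (pairDist X e)) :=
  infinitePi_volume_forall_lt s (fun e => g (pairDist X e)) fun _ => hg _

theorem injective_sym2_mk (i : ℕ) : Function.Injective fun j : ℕ => s(i, j) := fun a b h => by
  simp only [Sym2.eq_iff, true_and] at h
  rcases h with h | h
  · exact h
  · exact h.2.trans h.1

/-- Given the positions, the `n - 1` marks involved belong to distinct pairs and are independent;
given `X i = x`, the other positions then contribute identical independent factors. -/
theorem labelLaw_isolatedEvent (hg : ∀ x, g x ∈ Set.Icc (0 : ℝ) 1) (hgm : Measurable g)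
    (ν : Measure Plane) [IsProbabilityMeasure ν] {D : Set Plane} (hD : MeasurableSet D)
    {n i : ℕ} (hi : i < n) :
    labelLaw ν (isolatedEvent g D n i) =
      ∫⁻ x in D, (∫⁻ z, avoidProb g x z ∂ν) ^ (n - 1) ∂ν := by
  have hslice : ∀ X : ℕ → Plane,
      Measure.infinitePi (fun _ : Sym2 ℕ => (volume : Measure unitInterval))
        (Prod.mk X ⁻¹' isolatedEvent g D n i) =
      D.indicator 1 (X i) * ∏ j ∈ (Finset.range n).erase i, avoidProb g (X i) (X j) := by
    intro X
    by_cases hX : X i ∈ D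
    · have : Prod.mk X ⁻¹' isolatedEvent g D n i = {U | ∀ e ∈ ((Finset.range n).erase i).image
          fun j => s(i, j), g (pairDist X e) < U e} := by
        ext U; simp [isolatedEvent, hX]
        grind [pairDist_mk]
      rw [this, infinitePi_volume_marks hg, Finset.prod_image ((injective_sym2_mk i).injOn)]
      simp [hX, avoidProb]
    · have : Prod.mk X ⁻¹' isolatedEvent g D n i = ∅ := by
        ext U; simp [isolatedEvent, hX]
      simp [this, hX]
  rw [labelLaw, Measure.prod_apply (measurableSet_isolatedEvent hgm hD n i)]
  simp_rw [hslice]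
  have hprod : ∀ R : Finset ℕ, Measurable fun X : ℕ → Plane =>
      ∏ j ∈ R, avoidProb g (X i) (X j) := fun R =>
    Finset.measurable_fun_prod _ fun j _ =>
      measurable_avoidProb hgm (measurable_pi_apply i) (measurable_pi_apply j)
  have hind : ∀ l : ℕ, Measurable fun X : ℕ → Plane => D.indicator (1 : Plane → ℝ≥0∞) (X l) :=
    fun l => (measurable_one.indicator hD).comp (measurable_pi_apply l)
  have hmeas : Measurable fun X : ℕ → Plane => D.indicator (1 : Plane → ℝ≥0∞) (X i) *
      ∏ j ∈ (Finset.range n).erase i, avoidProb g (X i) (X j) := (hind i).mul (hprod _)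
  rw [lintegral_infinitePi_update ν i hmeas,
    ← lintegral_indicator hD]
  refine lintegral_congr fun x => ?_
  have hup : ∀ X : ℕ → Plane, D.indicator (1 : Plane → ℝ≥0∞) (Function.update X i x i) *
      ∏ j ∈ (Finset.range n).erase i,
        avoidProb g (Function.update X i x i) (Function.update X i x j) =
      D.indicator 1 x * ∏ j ∈ (Finset.range n).erase i, avoidProb g x (X j) := by
    intro X
    rw [Function.update_self]
    congr 1
    exact Finset.prod_congr rfl fun j hj => by
      rw [Function.update_of_ne (Finset.ne_of_mem_erase hj)]
  simp_rw [hup]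
  have hx : Measurable fun z => avoidProb g x z := measurable_avoidProb hgm measurable_const measurable_id
  rw [lintegral_const_mul _ (measurable_prod_coordinates hx _), lintegral_infinitePi_prod ν hx,
    Finset.card_erase_of_mem (Finset.mem_range.2 hi), Finset.card_range]
  by_cases hxD : x ∈ D <;> simp [hxD]

theorem labelLaw_isolatedEvent_inter (hg : ∀ x, g x ∈ Set.Icc (0 : ℝ) 1) (hgm : Measurable g)
    (ν : Measure Plane) [IsProbabilityMeasure ν] {D : Set Plane} (hD : MeasurableSet D)
    {n i k : ℕ} (hi : i < n) (hk : k < n) (hik : i ≠ k) :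
    labelLaw ν (isolatedEvent g D n i ∩ isolatedEvent g D n k) =
      ∫⁻ x in D, ∫⁻ y in D, avoidProb g x y *
        (∫⁻ z, avoidProb g x z * avoidProb g y z ∂ν) ^ (n - 2) ∂ν ∂ν := by
  set R : Finset ℕ := ((Finset.range n).erase i).erase k with hR
  have hRi : i ∉ R := by simp [hR]
  have hRk : k ∉ R := by simp [hR]
  have hRcard : R.card = n - 2 := by
    rw [hR, Finset.card_erase_of_mem (by simp [hk, hik.symm]),
      Finset.card_erase_of_mem (by simp [hi]), Finset.card_range]
    lia
  have hslice : ∀ X : ℕ → Plane,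
      Measure.infinitePi (fun _ : Sym2 ℕ => (volume : Measure unitInterval))
        (Prod.mk X ⁻¹' (isolatedEvent g D n i ∩ isolatedEvent g D n k)) =
      D.indicator 1 (X i) * (D.indicator 1 (X k) * (avoidProb g (X i) (X k) *
        ∏ j ∈ R, (avoidProb g (X i) (X j) * avoidProb g (X k) (X j)))) := by
    intro X
    by_cases hXi : X i ∈ D
    swap
    · have : Prod.mk X ⁻¹' (isolatedEvent g D n i ∩ isolatedEvent g D n k) = ∅ := by
        ext U; simp [isolatedEvent, hXi]
      simp [this, hXi]
    by_cases hXk : X k ∈ D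
    swap
    · have : Prod.mk X ⁻¹' (isolatedEvent g D n i ∩ isolatedEvent g D n k) = ∅ := by
        ext U; simp [isolatedEvent, hXk]
      simp [this, hXk]
    -- Both events constrain the mark of `s(i, k)`, which must be counted once; the remaining `2 (n
    -- - 2)` pairs are distinct.
    have hset : Prod.mk X ⁻¹' (isolatedEvent g D n i ∩ isolatedEvent g D n k) =
        {U | ∀ e ∈ insert s(i, k) (R.image (fun j => s(i, j)) ∪ R.image fun j => s(k, j)),
          g (pairDist X e) < U e} := by
      ext U
      simp only [isolatedEvent, Set.mem_preimage, Set.mem_inter_iff, Set.mem_ofPred_eq, hXi, hXk,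
        true_and]
      constructor
      · rintro ⟨h1, h2⟩ e he
        simp only [Finset.mem_insert, Finset.mem_union, Finset.mem_image] at he
        rcases he with rfl | ⟨j, hj, rfl⟩ | ⟨j, hj, rfl⟩
        · exact h1 k (by simp [hk, hik.symm])
        · exact h1 j (Finset.mem_of_mem_erase hj)
        · exact h2 j (by
            simp only [hR, Finset.mem_erase] at hj ⊢
            exact ⟨hj.1, hj.2.2⟩)
      · intro h
        have hmem : s(i, k) ∈ insert s(i, k)
            (R.image (fun j => s(i, j)) ∪ R.image fun j => s(k, j)) := by simp
        refine ⟨fun j hj => ?_, fun j hj => ?_⟩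
        · by_cases hjk : j = k
          · subst hjk; exact h _ hmem
          · refine h s(i, j) ?_
            refine Finset.mem_insert_of_mem (Finset.mem_union_left _ ?_)
            exact Finset.mem_image_of_mem _ (Finset.mem_erase.2 ⟨hjk, hj⟩)
        · by_cases hji : j = i
          · subst hji
            have := h _ hmem
            rw [Sym2.eq_swap] at this
            exact this
          · refine h s(k, j) ?_
            refine Finset.mem_insert_of_mem (Finset.mem_union_right _ ?_)
            refine Finset.mem_image_of_mem (fun j => s(k, j)) ?_
            simp only [hR, Finset.mem_erase] at hj ⊢
            exact ⟨hj.1, hji, hj.2⟩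
    have hnotMem : s(i, k) ∉ R.image (fun j => s(i, j)) ∪ R.image fun j => s(k, j) := by
      simp only [Finset.mem_union, Finset.mem_image, not_or, not_exists, not_and]
      refine ⟨fun j hj h => ?_, fun j hj h => ?_⟩
      · exact hRk ((injective_sym2_mk i h) ▸ hj)
      · rw [Sym2.eq_swap (a := i)] at h
        exact hRi ((injective_sym2_mk k h) ▸ hj)
    have hdisj : Disjoint (R.image fun j => s(i, j)) (R.image fun j => s(k, j)) := by
      rw [Finset.disjoint_left]
      intro e he he'
      simp only [Finset.mem_image] at he he'
      obtain ⟨j, hj, rfl⟩ := he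
      obtain ⟨l, hl, h⟩ := he'
      rw [Sym2.eq_iff] at h
      rcases h with h | h
      · exact hik h.1.symm
      · exact hRk (h.1 ▸ hj)
    rw [hset, infinitePi_volume_marks hg, Finset.prod_insert hnotMem, Finset.prod_union hdisj,
      Finset.prod_image ((injective_sym2_mk i).injOn),
      Finset.prod_image ((injective_sym2_mk k).injOn), ← Finset.prod_mul_distrib]
    simp [hXi, hXk, avoidProb]
  rw [labelLaw, Measure.prod_apply ((measurableSet_isolatedEvent hgm hD n i).inter
    (measurableSet_isolatedEvent hgm hD n k))]
  simp_rw [hslice]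
  have hprod : ∀ {u v : (ℕ → Plane) → Plane}, Measurable u → Measurable v →
      Measurable fun X : ℕ → Plane =>
        avoidProb g (u X) (v X) * ∏ j ∈ R, (avoidProb g (u X) (X j) * avoidProb g (v X) (X j)) :=
    fun hu hv => (measurable_avoidProb hgm hu hv).mul (Finset.measurable_fun_prod _ fun j _ =>
      (measurable_avoidProb hgm hu (measurable_pi_apply j)).mul (measurable_avoidProb hgm hv (measurable_pi_apply j)))
  have hind : ∀ l : ℕ, Measurable fun X : ℕ → Plane => D.indicator (1 : Plane → ℝ≥0∞) (X l) :=
    fun l => (measurable_one.indicator hD).comp (measurable_pi_apply l)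
  have hmeas : Measurable fun X : ℕ → Plane => D.indicator (1 : Plane → ℝ≥0∞) (X i) *
      (D.indicator 1 (X k) * (avoidProb g (X i) (X k) *
        ∏ j ∈ R, (avoidProb g (X i) (X j) * avoidProb g (X k) (X j)))) :=
    (hind i).mul ((hind k).mul (hprod (measurable_pi_apply i) (measurable_pi_apply k)))
  rw [lintegral_infinitePi_update ν i hmeas,
    ← lintegral_indicator hD]
  refine lintegral_congr fun x => ?_
  have hup : ∀ X : ℕ → Plane, D.indicator (1 : Plane → ℝ≥0∞) (Function.update X i x i) *
      (D.indicator 1 (Function.update X i x k) *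
        (avoidProb g (Function.update X i x i) (Function.update X i x k) *
          ∏ j ∈ R, (avoidProb g (Function.update X i x i) (Function.update X i x j) *
            avoidProb g (Function.update X i x k) (Function.update X i x j)))) =
      D.indicator 1 x * (D.indicator 1 (X k) * (avoidProb g x (X k) *
        ∏ j ∈ R, (avoidProb g x (X j) * avoidProb g (X k) (X j)))) := by
    intro X
    rw [Function.update_self, Function.update_of_ne hik.symm]
    congr 3
    exact Finset.prod_congr rfl fun j hj => by
      rw [Function.update_of_ne (ne_of_mem_of_not_mem hj hRi)]
  simp_rw [hup]
  have hmeasx : Measurable fun X : ℕ → Plane => D.indicator (1 : Plane → ℝ≥0∞) (X k) *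
      (avoidProb g x (X k) * ∏ j ∈ R, (avoidProb g x (X j) * avoidProb g (X k) (X j))) :=
    (hind k).mul (hprod measurable_const (measurable_pi_apply k))
  rw [lintegral_const_mul _ hmeasx]
  by_cases hxD : x ∈ D
  swap
  · simp [hxD]
  rw [Set.indicator_of_mem hxD, Set.indicator_of_mem hxD, Pi.one_apply, one_mul,
    lintegral_infinitePi_update ν k hmeasx, ← lintegral_indicator hD]
  refine lintegral_congr fun y => ?_
  have hup' : ∀ X : ℕ → Plane, D.indicator (1 : Plane → ℝ≥0∞) (Function.update X k y k) *
      (avoidProb g x (Function.update X k y k) * ∏ j ∈ R, (avoidProb g x (Function.update X k y j) *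
        avoidProb g (Function.update X k y k) (Function.update X k y j))) =
      D.indicator 1 y * avoidProb g x y *
        ∏ j ∈ R, (avoidProb g x (X j) * avoidProb g y (X j)) := by
    intro X
    rw [Function.update_self, ← mul_assoc]
    congr 1
    exact Finset.prod_congr rfl fun j hj => by
      rw [Function.update_of_ne (ne_of_mem_of_not_mem hj hRk)]
  simp_rw [hup']
  have hxy : Measurable fun z => avoidProb g x z * avoidProb g y z :=
    (measurable_avoidProb hgm measurable_const measurable_id).mul (measurable_avoidProb hgm measurable_const measurable_id)
  rw [lintegral_const_mul _ (measurable_prod_coordinates hxy _), lintegral_infinitePi_prod ν hxy, hRcard]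
  by_cases hyD : y ∈ D <;> simp [hyD]

end

end RandomConnection

/-! ### First and second moments of the number of isolated nodes. -/

namespace RandomConnection

open scoped ENNReal NNReal

/-- The number of isolated nodes in `D`. -/
noncomputable def isolatedCount (g : ℝ → ℝ) (D : Set Plane) (ω : Sample) : ℝ≥0∞ :=
  ∑ i ∈ Finset.range ω.1, (isolatedEvent g D ω.1 i).indicator 1 ω.2

/-- The event that there is an isolated node in `D`. -/
def existsIsolated (g : ℝ → ℝ) (D : Set Plane) : Set Sample :=
  {ω | ∃ i < ω.1, ω.2 ∈ isolatedEvent g D ω.1 i}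

/-- The probability that a random node is not adjacent to `x`. -/
noncomputable def missProb (g : ℝ → ℝ) (ν : Measure Plane) (x : Plane) : ℝ≥0∞ :=
  ∫⁻ z, avoidProb g x z ∂ν

/-- The probability that a random node is adjacent neither to `x` nor to `y`. -/
noncomputable def missProb₂ (g : ℝ → ℝ) (ν : Measure Plane) (x y : Plane) : ℝ≥0∞ :=
  ∫⁻ z, avoidProb g x z * avoidProb g y z ∂ν

/-- The expected number of isolated nodes in `D`. -/
noncomputable def isolatedMean (g : ℝ → ℝ) (ν : Measure Plane) (m : ℝ≥0) (D : Set Plane) : ℝ≥0∞ :=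
  ∫⁻ x in D, ENNReal.ofReal (m * Real.exp (-(m * (1 - (missProb g ν x).toReal)))) ∂ν

/-- The second factorial moment of the number of isolated nodes in `D`. -/
noncomputable def isolatedMean₂ (g : ℝ → ℝ) (ν : Measure Plane) (m : ℝ≥0) (D : Set Plane) :
    ℝ≥0∞ :=
  ∫⁻ x in D, ∫⁻ y in D, avoidProb g x y *
    ENNReal.ofReal (m ^ 2 * Real.exp (-(m * (1 - (missProb₂ g ν x y).toReal)))) ∂ν ∂ν

section

variable {g : ℝ → ℝ}

theorem missProb_le_one (hg : ∀ x, g x ∈ Set.Icc (0 : ℝ) 1) (ν : Measure Plane)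
    [IsProbabilityMeasure ν] (x : Plane) : missProb g ν x ≤ 1 := by
  refine (lintegral_mono fun z => avoidProb_le_one hg x z).trans ?_
  simp

theorem missProb₂_le_one (hg : ∀ x, g x ∈ Set.Icc (0 : ℝ) 1) (ν : Measure Plane)
    [IsProbabilityMeasure ν] (x y : Plane) : missProb₂ g ν x y ≤ 1 := by
  refine (lintegral_mono fun z =>
    mul_le_one' (avoidProb_le_one hg x z) (avoidProb_le_one hg y z)).trans ?_
  simp

theorem measurable_missProb (hg : Measurable g) (ν : Measure Plane) [SFinite ν] :
    Measurable (missProb g ν) :=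
  Measurable.lintegral_prod_right' (f := fun p : Plane × Plane => avoidProb g p.1 p.2)
    (measurable_avoidProb hg measurable_fst measurable_snd)

theorem measurable_missProb₂ (hg : Measurable g) (ν : Measure Plane) [SFinite ν] :
    Measurable fun p : Plane × Plane => missProb₂ g ν p.1 p.2 :=
  Measurable.lintegral_prod_right'
    (f := fun p : (Plane × Plane) × Plane => avoidProb g p.1.1 p.2 * avoidProb g p.1.2 p.2)
    ((measurable_avoidProb hg measurable_fst.fst measurable_snd).mul
      (measurable_avoidProb hg measurable_fst.snd measurable_snd))

theorem measurable_isolatedCount (hg : Measurable g) {D : Set Plane} (hD : MeasurableSet D) :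
    Measurable (isolatedCount g D) :=
  measurable_from_prod_countable_right fun n =>
    Finset.measurable_fun_sum (Finset.range n) fun i _ =>
      measurable_one.indicator (measurableSet_isolatedEvent hg hD n i)

theorem measurableSet_existsIsolated (hg : Measurable g) {D : Set Plane} (hD : MeasurableSet D) :
    MeasurableSet (existsIsolated g D) := by
  have : existsIsolated g D = {ω | isolatedCount g D ω ≠ 0} := by
    ext ω
    simp [existsIsolated, isolatedCount]
  rw [this]
  exact (measurable_isolatedCount hg hD (measurableSet_singleton 0)).compl

theorem lintegral_isolatedCount_sections (hg : ∀ x, g x ∈ Set.Icc (0 : ℝ) 1) (hgm : Measurable g)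
    (ν : Measure Plane) [IsProbabilityMeasure ν] {D : Set Plane} (hD : MeasurableSet D) (n : ℕ) :
    ∫⁻ u, isolatedCount g D (n, u) ∂(labelLaw ν) =
      ∫⁻ x in D, n.descFactorial 1 * missProb g ν x ^ (n - 1) ∂ν := by
  simp only [isolatedCount]
  rw [lintegral_finsetSum _ fun i _ =>
    measurable_one.indicator (measurableSet_isolatedEvent hgm hD n i)]
  rw [lintegral_const_mul _ ((measurable_missProb hgm ν).pow_const _)]
  rw [Finset.sum_congr rfl fun i hi => by
    rw [lintegral_indicator_one (measurableSet_isolatedEvent hgm hD n i),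
      labelLaw_isolatedEvent hg hgm ν hD (Finset.mem_range.1 hi)]]
  simp [missProb]

theorem lintegral_isolatedCount (hg : ∀ x, g x ∈ Set.Icc (0 : ℝ) 1) (hgm : Measurable g)
    (ν : Measure Plane) [IsProbabilityMeasure ν] (m : ℝ≥0) {D : Set Plane} (hD : MeasurableSet D) :
    ∫⁻ ω, isolatedCount g D ω ∂((poissonMeasure m).prod (labelLaw ν)) =
      isolatedMean g ν m D := by
  rw [lintegral_prod _ (measurable_isolatedCount hgm hD).aemeasurable]
  simp_rw [lintegral_isolatedCount_sections hg hgm ν hD]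
  rw [lintegral_lintegral_swap]
  · refine lintegral_congr fun x => ?_
    rw [lintegral_descFactorial_mul_pow_poissonMeasure m 1 (missProb_le_one hg ν x), pow_one]
  · refine Measurable.aemeasurable (measurable_from_prod_countable_right fun n => ?_)
    exact ((measurable_missProb hgm ν).pow_const (n - 1)).const_mul (n.descFactorial 1 : ℝ≥0∞)

/-- In the square of a sum of indicators the diagonal reproduces the sum, and the `n (n - 1)`
off-diagonal terms all have the same integral. -/
theorem lintegral_isolatedCount_sq_sections (hg : ∀ x, g x ∈ Set.Icc (0 : ℝ) 1) (hgm : Measurable g)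
    (ν : Measure Plane) [IsProbabilityMeasure ν] {D : Set Plane} (hD : MeasurableSet D) (n : ℕ) :
    ∫⁻ u, isolatedCount g D (n, u) ^ 2 ∂(labelLaw ν) =
      ∫⁻ u, isolatedCount g D (n, u) ∂(labelLaw ν) +
      ∫⁻ x in D, ∫⁻ y in D, avoidProb g x y *
        (n.descFactorial 2 * missProb₂ g ν x y ^ (n - 2)) ∂ν ∂ν := by
  have hsq : ∀ u, isolatedCount g D (n, u) ^ 2 = isolatedCount g D (n, u) +
      ∑ p ∈ (Finset.range n).offDiag,
        (isolatedEvent g D n p.1 ∩ isolatedEvent g D n p.2).indicator 1 u := by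
    intro u
    simp only [isolatedCount]
    rw [sq, Finset.sum_mul_sum, ← Finset.sum_product', ← Finset.diag_union_offDiag,
      Finset.sum_union (Finset.disjoint_diag_offDiag _), Finset.sum_diag]
    congr 1
    · refine Finset.sum_congr rfl fun i _ => ?_
      by_cases h : u ∈ isolatedEvent g D n i <;> simp [h]
    · refine Finset.sum_congr rfl fun p _ => ?_
      rw [Set.inter_indicator_one]; rfl
  simp_rw [hsq]
  have hcount : Measurable fun u => isolatedCount g D (n, u) :=
    (measurable_isolatedCount hgm hD).comp measurable_prodMk_left
  rw [lintegral_add_left hcount]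
  congr 1
  have hms := measurableSet_isolatedEvent hgm hD n
  rw [lintegral_finsetSum _ fun p _ => measurable_one.indicator ((hms p.1).inter (hms p.2))]
  have hterm : ∀ p ∈ (Finset.range n).offDiag,
      ∫⁻ u, (isolatedEvent g D n p.1 ∩ isolatedEvent g D n p.2).indicator 1 u ∂(labelLaw ν) =
        ∫⁻ x in D, ∫⁻ y in D, avoidProb g x y * missProb₂ g ν x y ^ (n - 2) ∂ν ∂ν := by
    intro p hp
    rw [Finset.mem_offDiag] at hp
    rw [lintegral_indicator_one ((hms p.1).inter (hms p.2)),
      labelLaw_isolatedEvent_inter hg hgm ν hD (Finset.mem_range.1 hp.1)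
        (Finset.mem_range.1 hp.2.1) hp.2.2]
    rfl
  rw [Finset.sum_congr rfl hterm, Finset.sum_const, Finset.offDiag_card, Finset.card_range,
    nsmul_eq_mul]
  have hcard : n * n - n = n.descFactorial 2 := by
    cases n with
    | zero => rfl
    | succ n => simp [Nat.descFactorial, Nat.add_mul]
  have hmeas : Measurable fun p : Plane × Plane =>
      avoidProb g p.1 p.2 * missProb₂ g ν p.1 p.2 ^ (n - 2) :=
    (measurable_avoidProb hgm measurable_fst measurable_snd).mul
      ((measurable_missProb₂ hgm ν).pow_const _)
  rw [hcard, ← lintegral_const_mul _ hmeas.lintegral_prod_right']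
  refine lintegral_congr fun x => ?_
  have hx := hmeas.comp (measurable_prodMk_left (x := x))
  simp only [Function.comp_def] at hx
  rw [← lintegral_const_mul _ hx]
  refine lintegral_congr fun y => ?_
  ring

theorem lintegral_isolatedCount_sq (hg : ∀ x, g x ∈ Set.Icc (0 : ℝ) 1) (hgm : Measurable g)
    (ν : Measure Plane) [IsProbabilityMeasure ν] (m : ℝ≥0) {D : Set Plane} (hD : MeasurableSet D) :
    ∫⁻ ω, isolatedCount g D ω ^ 2 ∂((poissonMeasure m).prod (labelLaw ν)) =
      isolatedMean g ν m D + isolatedMean₂ g ν m D := by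
  rw [← lintegral_isolatedCount hg hgm ν m hD,
    lintegral_prod _ ((measurable_isolatedCount hgm hD).pow_const 2).aemeasurable,
    lintegral_prod _ (measurable_isolatedCount hgm hD).aemeasurable]
  simp_rw [lintegral_isolatedCount_sq_sections hg hgm ν hD]
  rw [lintegral_add_left (measurable_of_countable _)]
  congr 1
  have hmeas : ∀ n : ℕ, Measurable fun p : Plane × Plane =>
      avoidProb g p.1 p.2 * (n.descFactorial 2 * missProb₂ g ν p.1 p.2 ^ (n - 2)) := fun n =>
    (measurable_avoidProb hgm measurable_fst measurable_snd).mul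
      (((measurable_missProb₂ hgm ν).pow_const _).const_mul _)
  rw [lintegral_lintegral_swap]
  · refine lintegral_congr fun x => ?_
    rw [lintegral_lintegral_swap]
    · refine lintegral_congr fun y => ?_
      rw [lintegral_const_mul _ (measurable_of_countable _),
        lintegral_descFactorial_mul_pow_poissonMeasure m 2 (missProb₂_le_one hg ν x y)]
    · have hn : ∀ n : ℕ, Measurable fun y : Plane =>
          avoidProb g x y * (n.descFactorial 2 * missProb₂ g ν x y ^ (n - 2)) := fun n => by
        have h := (hmeas n).comp (measurable_prodMk_left (x := x))
        simpa only [Function.comp_def] using h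
      refine Measurable.aemeasurable (measurable_from_prod_countable_right fun n => ?_)
      exact hn n
  · have hn : ∀ n : ℕ, Measurable fun x : Plane => ∫⁻ y in D,
        avoidProb g x y * (n.descFactorial 2 * missProb₂ g ν x y ^ (n - 2)) ∂ν := fun n =>
      (hmeas n).lintegral_prod_right'
    refine Measurable.aemeasurable (measurable_from_prod_countable_right fun n => ?_)
    exact hn n

/-- The second moment bound for the probability that there is an isolated node. -/
theorem two_mul_isolatedMean_le (hg : ∀ x, g x ∈ Set.Icc (0 : ℝ) 1) (hgm : Measurable g)
    (ν : Measure Plane) [IsProbabilityMeasure ν] (m : ℝ≥0) {D : Set Plane} (hD : MeasurableSet D)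
    (t : ℝ≥0∞) :
    2 * t * isolatedMean g ν m D ≤
      ((poissonMeasure m).prod (labelLaw ν)) (existsIsolated g D) +
        t ^ 2 * (isolatedMean g ν m D + isolatedMean₂ g ν m D) := by
  have hcount := measurable_isolatedCount hgm hD
  rw [← lintegral_isolatedCount_sq hg hgm ν m hD, ← lintegral_isolatedCount hg hgm ν m hD,
    ← lintegral_const_mul _ hcount, ← lintegral_const_mul _ (hcount.pow_const 2),
    ← lintegral_indicator_one (measurableSet_existsIsolated hgm hD),
    ← lintegral_add_left (measurable_one.indicator (measurableSet_existsIsolated hgm hD))]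
  refine lintegral_mono fun ω => ?_
  by_cases hω : ω ∈ existsIsolated g D
  -- Pointwise `2 t N ≤ 1 + t² N²`; off the event `N = 0`, so the `1` becomes the indicator.
  · simpa [hω, mul_pow, mul_assoc] using ennreal_two_mul_le_add_sq 1 (t * isolatedCount g D ω)
  · have : isolatedCount g D ω = 0 := by
      rw [isolatedCount]
      refine Finset.sum_eq_zero fun i hi => Set.indicator_of_notMem (fun h => hω ?_) _
      exact ⟨i, Finset.mem_range.1 hi, h⟩
    simp [this]

end

/-- The one-node graph is connected although its node is isolated, hence the exceptional set `n =
1`. -/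
theorem connected_subset (g : ℝ → ℝ) (D : Set Plane) :
    {ω : Sample | (graph g ω).Connected} ⊆ (existsIsolated g D)ᶜ ∪ {1} ×ˢ Set.univ := by
  rintro ⟨n, X, U⟩ hconn
  by_contra hnot
  simp only [Set.mem_union, Set.mem_compl_iff, not_or, not_not, Set.mem_prod,
    Set.mem_singleton_iff, Set.mem_univ, and_true] at hnot
  obtain ⟨⟨i, hi, -, hiso⟩, hn⟩ := hnot
  simp only at hi hiso hn
  have hconn : (graph g (n, X, U)).Connected := hconn
  have : Nontrivial (Fin n) := Fin.nontrivial_iff_two_le.2 (by lia)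
  obtain ⟨j, hj⟩ := hconn.preconnected.exists_adj_of_nontrivial (⟨i, hi⟩ : Fin n)
  have hji : (j : ℕ) ≠ i := fun h => hj.1 (Fin.ext h.symm)
  exact absurd hj.2 (not_le.2 (hiso j (by simp [hji, j.2])))

end RandomConnection

/-! ### Bounds on the two moments. -/

namespace RandomConnection

open scoped ENNReal NNReal

section

variable {g : ℝ → ℝ}

theorem integrable_comp_dist (hg : ∀ x, g x ∈ Set.Icc (0 : ℝ) 1) (hgm : Measurable g)
    (ν : Measure Plane) [IsFiniteMeasure ν] (x : Plane) :
    Integrable (fun z => g (dist x z)) ν := by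
  refine Integrable.of_bound (hgm.comp (measurable_const.dist measurable_id)).aestronglyMeasurable
    1 (Eventually.of_forall fun z => ?_)
  rw [Real.norm_eq_abs, abs_of_nonneg (hg _).1]
  exact (hg _).2

theorem integrable_comp_dist_mul (hg : ∀ x, g x ∈ Set.Icc (0 : ℝ) 1) (hgm : Measurable g)
    (ν : Measure Plane) [IsFiniteMeasure ν] (x y : Plane) :
    Integrable (fun z => g (dist x z) * g (dist y z)) ν := by
  refine Integrable.of_bound ((hgm.comp (measurable_const.dist measurable_id)).mul
    (hgm.comp (measurable_const.dist measurable_id))).aestronglyMeasurable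
    1 (Eventually.of_forall fun z => ?_)
  rw [Real.norm_eq_abs, abs_of_nonneg (mul_nonneg (hg _).1 (hg _).1)]
  exact mul_le_one₀ (hg _).2 (hg _).1 (hg _).2

theorem one_sub_missProb_toReal (hg : ∀ x, g x ∈ Set.Icc (0 : ℝ) 1) (hgm : Measurable g)
    (ν : Measure Plane) [IsProbabilityMeasure ν] (x : Plane) :
    1 - (missProb g ν x).toReal = ∫ z, g (dist x z) ∂ν := by
  have hint := integrable_comp_dist hg hgm ν x
  have h : (missProb g ν x).toReal = ∫ z, (1 - g (dist x z)) ∂ν := by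
    rw [integral_eq_lintegral_of_nonneg_ae (Eventually.of_forall fun z => sub_nonneg.2 (hg _).2)
      ((integrable_const _).sub hint).aestronglyMeasurable]
    rfl
  rw [h, integral_sub (integrable_const _) hint]
  simp

theorem one_sub_missProb₂_toReal (hg : ∀ x, g x ∈ Set.Icc (0 : ℝ) 1) (hgm : Measurable g)
    (ν : Measure Plane) [IsProbabilityMeasure ν] (x y : Plane) :
    1 - (missProb₂ g ν x y).toReal =
      ∫ z, g (dist x z) ∂ν + ∫ z, g (dist y z) ∂ν - ∫ z, g (dist x z) * g (dist y z) ∂ν := by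
  have hx := integrable_comp_dist hg hgm ν x
  have hy := integrable_comp_dist hg hgm ν y
  have hxy := integrable_comp_dist_mul hg hgm ν x y
  have hadd : Integrable (fun z => g (dist x z) + g (dist y z)) ν := hx.add hy
  have hsum : Integrable (fun z => g (dist x z) + g (dist y z) - g (dist x z) * g (dist y z)) ν :=
    hadd.sub hxy
  have h : (missProb₂ g ν x y).toReal = ∫ z, (1 - g (dist x z)) * (1 - g (dist y z)) ∂ν := by
    rw [integral_eq_lintegral_of_nonneg_ae (Eventually.of_forall fun z =>
      mul_nonneg (sub_nonneg.2 (hg _).2) (sub_nonneg.2 (hg _).2))]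
    · simp only [missProb₂, avoidProb]
      congr 1
      refine lintegral_congr fun z => ?_
      rw [ENNReal.ofReal_mul (sub_nonneg.2 (hg _).2)]
    · refine (((integrable_const (1 : ℝ)).sub hsum).congr
        (Eventually.of_forall fun z => ?_)).aestronglyMeasurable
      simp only [Pi.sub_apply]
      ring
  have h' : (missProb₂ g ν x y).toReal = ∫ z, (1 - (g (dist x z) + g (dist y z) -
      g (dist x z) * g (dist y z))) ∂ν := by
    rw [h]; exact integral_congr_ae (Eventually.of_forall fun z => by ring)
  rw [h', integral_sub (integrable_const _) hsum, integral_sub hadd hxy,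
    integral_add hx hy]
  simp

/-- Every `z` is at distance at least `R / 2` from `x` or from `y`, so one of the two factors is at
most `g (R / 2)`. -/
theorem integral_comp_dist_mul_le (hg : ∀ x, g x ∈ Set.Icc (0 : ℝ) 1) (hanti : Antitone g)
    (ν : Measure Plane) [IsFiniteMeasure ν] {x y : Plane} {R : ℝ} (hxy : R ≤ dist x y) :
    ∫ z, g (dist x z) * g (dist y z) ∂ν ≤
      g (R / 2) * (∫ z, g (dist x z) ∂ν + ∫ z, g (dist y z) ∂ν) := by
  have hgm := hanti.measurable
  have hx := integrable_comp_dist hg hgm ν x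
  have hy := integrable_comp_dist hg hgm ν y
  rw [← integral_add hx hy, ← integral_const_mul]
  refine integral_mono (integrable_comp_dist_mul hg hgm ν x y) ((hx.add hy).const_mul _)
    fun z => ?_
  simp only
  have htri := dist_triangle_right x y z
  have hR := (hg (R / 2)).1
  have h1 := (hg (dist x z)).1
  have h2 := (hg (dist y z)).1
  rcases le_total (R / 2) (dist x z) with h | h
  · have := hanti h
    nlinarith [mul_le_mul_of_nonneg_right this h2, mul_nonneg hR h1]
  · have := hanti (show R / 2 ≤ dist y z by linarith)
    nlinarith [mul_le_mul_of_nonneg_left this h1, mul_nonneg hR h2]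

theorem isolatedMean_eq (hg : ∀ x, g x ∈ Set.Icc (0 : ℝ) 1) (hgm : Measurable g)
    (ν : Measure Plane) [IsProbabilityMeasure ν] (m : ℝ≥0) (D : Set Plane) :
    isolatedMean g ν m D =
      ∫⁻ x in D, ENNReal.ofReal (m * Real.exp (-(m * ∫ z, g (dist x z) ∂ν))) ∂ν := by
  simp_rw [isolatedMean, one_sub_missProb_toReal hg hgm ν]

theorem le_isolatedMean (hg : ∀ x, g x ∈ Set.Icc (0 : ℝ) 1) (hgm : Measurable g)
    (ν : Measure Plane) [IsProbabilityMeasure ν] (m : ℝ≥0) (D : Set Plane) {K : ℝ}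
    (hK : ∀ x, m * ∫ z, g (dist x z) ∂ν ≤ K) :
    ENNReal.ofReal (m * Real.exp (-K)) * ν D ≤ isolatedMean g ν m D := by
  rw [isolatedMean_eq hg hgm, ← setLIntegral_const]
  refine lintegral_mono fun x => ENNReal.ofReal_le_ofReal ?_
  have := hK x
  gcongr

/-- Provides finiteness of the mean, so that the second moment inequality can be solved in the
reals. -/
theorem isolatedMean_le (hg : ∀ x, g x ∈ Set.Icc (0 : ℝ) 1)
    (ν : Measure Plane) [IsProbabilityMeasure ν] (m : ℝ≥0) (D : Set Plane) :
    isolatedMean g ν m D ≤ m := by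
  have hle : ∀ x, ENNReal.ofReal (m * Real.exp (-(m * (1 - (missProb g ν x).toReal)))) ≤ m := by
    intro x
    rw [← ENNReal.ofReal_coe_nnreal]
    refine ENNReal.ofReal_le_ofReal (mul_le_of_le_one_right m.coe_nonneg (Real.exp_le_one_iff.2 ?_))
    have : (missProb g ν x).toReal ≤ 1 :=
      ENNReal.toReal_le_of_le_ofReal zero_le_one (by simpa using missProb_le_one hg ν x)
    have := mul_nonneg m.coe_nonneg (sub_nonneg.2 this)
    linarith
  refine (lintegral_mono hle).trans ?_
  rw [setLIntegral_const]
  exact mul_le_of_le_one_right (zero_le) prob_le_one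

/-- Pairs of isolated nodes at distance at least `R` are nearly uncorrelated, and the near ones are
few. -/
theorem isolatedMean₂_le (hg : ∀ x, g x ∈ Set.Icc (0 : ℝ) 1) (hgm : Measurable g)
    (ν : Measure Plane) [IsProbabilityMeasure ν] (m : ℝ≥0) {D : Set Plane} (hD : MeasurableSet D)
    {R η κ V : ℝ}
    (hfar : ∀ x y, R ≤ dist x y → m * ∫ z, g (dist x z) * g (dist y z) ∂ν ≤ η)
    (hnear : ∀ x ∈ D, ∀ y ∈ D, g (dist x y) = 1 ∨
      κ ≤ m * ∫ z, g (dist y z) * (1 - g (dist x z)) ∂ν)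
    (hV : ∀ x, m * ν (Metric.ball x R) ≤ ENNReal.ofReal V) :
    isolatedMean₂ g ν m D ≤ ENNReal.ofReal (Real.exp η) * isolatedMean g ν m D ^ 2 +
      ENNReal.ofReal (V * Real.exp (-κ)) * isolatedMean g ν m D := by
  set a : Plane → ℝ≥0∞ := fun x =>
    ENNReal.ofReal (m * Real.exp (-(m * ∫ z, g (dist x z) ∂ν))) with ha
  have hmean : isolatedMean g ν m D = ∫⁻ x in D, a x ∂ν := isolatedMean_eq hg hgm ν m D
  have hameas : Measurable a := by
    have : a = fun x => ENNReal.ofReal (m * Real.exp (-(m * (1 - (missProb g ν x).toReal)))) := by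
      funext x; rw [one_sub_missProb_toReal hg hgm ν]
    rw [this]
    have := measurable_missProb hgm ν
    fun_prop
  set q := ENNReal.ofReal (m * Real.exp (-κ)) with hq
  have hpoint : ∀ x ∈ D, ∀ y ∈ D, avoidProb g x y *
      ENNReal.ofReal (m ^ 2 * Real.exp (-(m * (1 - (missProb₂ g ν x y).toReal)))) ≤
      a x * (ENNReal.ofReal (Real.exp η) * a y + (Metric.ball x R).indicator (fun _ => q) y) := by
    intro x hx y hy
    rw [one_sub_missProb₂_toReal hg hgm ν]
    have hone : avoidProb g x y ≤ 1 := avoidProb_le_one hg x y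
    by_cases hR : R ≤ dist x y
    · refine (mul_le_of_le_one_left (zero_le) hone).trans ?_
      refine le_trans ?_ (mul_le_mul_right le_self_add _)
      rw [ha, ← ENNReal.ofReal_mul (by positivity), ← ENNReal.ofReal_mul (by positivity)]
      refine ENNReal.ofReal_le_ofReal ?_
      have h := hfar x y hR
      calc (m : ℝ) ^ 2 * Real.exp (-(m * (∫ z, g (dist x z) ∂ν + ∫ z, g (dist y z) ∂ν -
              ∫ z, g (dist x z) * g (dist y z) ∂ν)))
          ≤ m ^ 2 * Real.exp (-(m * ∫ z, g (dist x z) ∂ν) + (η + -(m * ∫ z, g (dist y z) ∂ν))) := by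
            gcongr; linarith
        _ = _ := by rw [Real.exp_add, Real.exp_add]; ring
    · rcases hnear x hx y hy with h1 | hκ
      -- Nodes joined with probability one cannot both be isolated: the factor `avoidProb g x y` is
      -- zero.
      · simp [avoidProb, h1]
      · refine (mul_le_of_le_one_left (zero_le) hone).trans ?_
        refine le_trans ?_ (mul_le_mul_right le_add_self _)
        rw [Set.indicator_of_mem (by rw [Metric.mem_ball, dist_comm]; exact not_le.1 hR), ha, hq,
          ← ENNReal.ofReal_mul (by positivity)]
        refine ENNReal.ofReal_le_ofReal ?_
        -- The exponent for the pair is that of `x` alone plus the part seen by `y` and missed by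
        -- `x`, which is at least `κ`.
        have hexcl : ∫ z, g (dist y z) * (1 - g (dist x z)) ∂ν =
            ∫ z, g (dist y z) ∂ν - ∫ z, g (dist x z) * g (dist y z) ∂ν := by
          rw [← integral_sub (integrable_comp_dist hg hgm ν y)
            (integrable_comp_dist_mul hg hgm ν x y)]
          exact integral_congr_ae (Eventually.of_forall fun z => by ring)
        rw [hexcl] at hκ
        calc (m : ℝ) ^ 2 * Real.exp (-(m * (∫ z, g (dist x z) ∂ν + ∫ z, g (dist y z) ∂ν -
                ∫ z, g (dist x z) * g (dist y z) ∂ν)))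
            ≤ m ^ 2 * Real.exp (-(m * ∫ z, g (dist x z) ∂ν) + -κ) := by
              gcongr; linarith
          _ = _ := by rw [Real.exp_add]; ring
  have hball : ∀ x, ∫⁻ y in D, (Metric.ball x R).indicator (fun _ => q) y ∂ν ≤
      ENNReal.ofReal (V * Real.exp (-κ)) := by
    intro x
    refine (setLIntegral_le_lintegral _ _).trans ?_
    rw [lintegral_indicator_const Metric.isOpen_ball.measurableSet, hq,
      ENNReal.ofReal_mul m.coe_nonneg, ENNReal.ofReal_mul' (Real.exp_pos _).le, mul_right_comm]
    have := hV x
    rw [ENNReal.ofReal_coe_nnreal]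
    gcongr
  calc isolatedMean₂ g ν m D
      ≤ ∫⁻ x in D, a x * (ENNReal.ofReal (Real.exp η) * isolatedMean g ν m D +
          ENNReal.ofReal (V * Real.exp (-κ))) ∂ν := by
        refine setLIntegral_mono' hD fun x hx => ?_
        refine (setLIntegral_mono' hD (hpoint x hx)).trans ?_
        have hind : Measurable ((Metric.ball x R).indicator fun _ : Plane => q) :=
          measurable_const.indicator Metric.isOpen_ball.measurableSet
        have hsum : Measurable fun y => ENNReal.ofReal (Real.exp η) * a y +
            (Metric.ball x R).indicator (fun _ => q) y := (hameas.const_mul _).add hind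
        rw [lintegral_const_mul _ hsum,
          lintegral_add_right _ hind, lintegral_const_mul _ hameas, ← hmean]
        gcongr
        exact hball x
    _ = _ := by
        rw [lintegral_mul_const _ hameas, ← hmean]; ring

end

end RandomConnection

/-! ### Geometry of the plane: private discs and squares. -/

namespace RandomConnection

open scoped ENNReal NNReal

theorem exists_unit_vector (x y : Plane) : ∃ u : Plane, ‖u‖ = 1 ∧ y - x = dist x y • u := by
  by_cases h : x = y
  · obtain ⟨u, hu⟩ := exists_norm_eq Plane zero_le_one
    exact ⟨u, hu, by simp [h]⟩
  · have hd : dist x y ≠ 0 := dist_ne_zero.2 h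
    refine ⟨(dist x y)⁻¹ • (y - x), ?_, by rw [smul_inv_smul₀ hd]⟩
    rw [norm_smul, norm_inv, Real.norm_eq_abs, abs_of_nonneg dist_nonneg, dist_comm x y,
      dist_eq_norm, inv_mul_cancel₀]
    rwa [← dist_eq_norm, dist_comm]

/-- If nodes at `x` and `y` may be non-adjacent, then some disc of a fixed size near `y` consists of
points that see `y` but not `x` with probability bounded below. -/
theorem exists_private_disc {g : ℝ → ℝ} (hg : ∀ x, g x ∈ Set.Icc (0 : ℝ) 1) (hanti : Antitone g)
    (hlim : Tendsto g atTop (𝓝 0)) {r : ℝ} (hr : 0 < r) (hgr : 0 < g r) :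
    ∃ δ > 0, ∀ x y : Plane, g (dist x y) = 1 ∨ ∃ w : Plane,
      Metric.closedBall w (r / 4) ⊆ Metric.closedBall y r ∧
        ∀ z ∈ Metric.closedBall w (r / 4), δ ≤ g (dist y z) * (1 - g (dist x z)) := by
  -- `sSup S` is the distance up to which adjacency is certain; inserting `0` keeps `S` nonempty
  -- when `g` never equals `1`.
  set S : Set ℝ := insert 0 {t | g t = 1} with hS
  have hbdd : BddAbove S := by
    obtain ⟨T, hT⟩ := (hlim.eventually (gt_mem_nhds zero_lt_one)).exists_forall_of_atTop
    refine bddAbove_insert.2 ⟨T, fun t ht => ?_⟩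
    by_contra! hlt
    exact (hT t hlt.le).ne ht
  have ha : ∀ t, sSup S < t → g t < 1 := fun t ht => lt_of_le_of_ne (hg t).2 fun h1 =>
    absurd (le_csSup hbdd (show t ∈ S from Or.inr h1)) (not_le.2 ht)
  have hlow : ∀ d, 0 ≤ d → d < sSup S → g d = 1 := by
    intro d hd hlt
    obtain ⟨t, ht, hdt⟩ := exists_lt_of_lt_csSup ⟨0, show (0 : ℝ) ∈ S from Or.inl rfl⟩ hlt
    rcases ht with rfl | ht
    · exact absurd hdt (not_lt.2 hd)
    · exact le_antisymm (hg d).2 (ht ▸ hanti hdt.le)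
  refine ⟨g r * (1 - g (sSup S + r / 2)),
    mul_pos hgr (sub_pos.2 (ha _ (by linarith))), fun x y => ?_⟩
  rcases lt_or_ge (dist x y) (sSup S) with hd | hd
  · exact Or.inl (hlow _ dist_nonneg hd)
  right
  obtain ⟨u, hu, hxy⟩ := exists_unit_vector x y
  have hnorm : ‖(3 / 4 * r) • u‖ = 3 / 4 * r := by
    rw [norm_smul, hu, mul_one, Real.norm_eq_abs, abs_of_pos (by positivity)]
  have hy : ∀ z ∈ Metric.closedBall (y + (3 / 4 * r) • u) (r / 4), dist y z ≤ r := by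
    intro z hz
    rw [Metric.mem_closedBall, dist_comm] at hz
    have h1 : dist y (y + (3 / 4 * r) • u) = 3 / 4 * r := by rw [dist_self_add_right, hnorm]
    linarith [dist_triangle y (y + (3 / 4 * r) • u) z]
  -- The disc lies beyond `y` as seen from `x`: its points are within `3r/4 + r/4 = r` of `y` and at
  -- least `dist x y + 3r/4 - r/4` from `x`.
  refine ⟨y + (3 / 4 * r) • u, fun z hz => ?_, fun z hz => ?_⟩
  · rw [Metric.mem_closedBall, dist_comm]; exact hy z hz
  · have hx : sSup S + r / 2 ≤ dist x z := by
      have h1 : dist x (y + (3 / 4 * r) • u) = dist x y + 3 / 4 * r := by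
        rw [dist_comm, dist_eq_norm]
        have : y + (3 / 4 * r) • u - x = (dist x y + 3 / 4 * r) • u := by
          rw [add_smul, ← hxy]; abel
        rw [this, norm_smul, hu, mul_one, Real.norm_eq_abs,
          abs_of_nonneg (by have := dist_nonneg (x := x) (y := y); positivity)]
      rw [Metric.mem_closedBall] at hz
      linarith [dist_triangle x z (y + (3 / 4 * r) • u)]
    exact mul_le_mul (hanti (hy z hz)) (sub_le_sub_left (hanti hx) 1)
      (sub_nonneg.2 (hg _).2) (hg _).1

theorem measurableSet_square (s : ℝ) : MeasurableSet (square s) := by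
  have : square s = ⋂ i : Fin 2, {x : Plane | x i ∈ Set.Icc (-(s / 2)) (s / 2)} := by
    ext x; simp [square]
  rw [this]
  exact MeasurableSet.iInter fun i => measurableSet_Icc.preimage (by fun_prop)

theorem volume_square {s : ℝ} (hs : 0 ≤ s) : volume (square s) = ENNReal.ofReal (s ^ 2) := by
  have hpre : square s = (MeasurableEquiv.toLp 2 (Fin 2 → ℝ)).symm ⁻¹'
      (Set.univ.pi fun _ => Set.Icc (-(s / 2)) (s / 2)) := by
    ext x; simp [square, Pi.le_def]; tauto
  rw [hpre, (EuclideanSpace.volume_preserving_symm_measurableEquiv_toLp (Fin 2)).measure_preimage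
    (MeasurableSet.univ_pi fun _ => measurableSet_Icc).nullMeasurableSet, volume_pi_pi]
  simp only [Real.volume_Icc, Finset.prod_const, Finset.card_univ, Fintype.card_fin]
  rw [← ENNReal.ofReal_pow (by linarith)]
  ring_nf

theorem closedBall_subset_square {s L : ℝ} {y : Plane} (hy : y ∈ square (s - 2 * L)) :
    Metric.closedBall y L ⊆ square s := by
  intro z hz i
  have hzi : |z i - y i| ≤ L := by
    rw [Metric.mem_closedBall, dist_eq_norm] at hz
    exact (PiLp.norm_apply_le (z - y) i).trans hz
  have := hy i
  rw [abs_le] at hzi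
  simp only [Set.mem_Icc] at this ⊢
  constructor <;> linarith [this.1, this.2, hzi.1, hzi.2]

theorem square_mono {s t : ℝ} (h : s ≤ t) : square s ⊆ square t := fun x hx i =>
  ⟨by linarith [(hx i).1], by linarith [(hx i).2]⟩

end RandomConnection

/-! ### The connectivity bound at a fixed density. -/

namespace RandomConnection

open scoped ENNReal NNReal

section

variable {g : ℝ → ℝ}

/-- The volume of the unit disc. -/
noncomputable def discArea : ℝ := volume.real (Metric.ball (0 : Plane) 1)

theorem discArea_nonneg : 0 ≤ discArea := measureReal_nonneg

theorem discArea_pos : 0 < discArea :=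
  ENNReal.toReal_pos (Metric.measure_ball_pos _ _ one_pos).ne' measure_ball_lt_top.ne

theorem volume_ball_plane (x : Plane) {R : ℝ} (hR : 0 ≤ R) :
    volume (Metric.ball x R) = ENNReal.ofReal (discArea * R ^ 2) := by
  rw [Measure.addHaar_ball _ _ hR, discArea, mul_comm, ENNReal.ofReal_mul measureReal_nonneg,
    ofReal_measureReal measure_ball_lt_top.ne]
  simp

theorem volume_real_closedBall_plane (x : Plane) {R : ℝ} (hR : 0 ≤ R) :
    volume.real (Metric.closedBall x R) = discArea * R ^ 2 := by
  rw [Measure.real, Measure.addHaar_closedBall _ _ hR, discArea, mul_comm, ENNReal.toReal_mul,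
    ENNReal.toReal_ofReal (by positivity)]
  simp [Measure.real]

theorem mul_integral_cond (lam : ℝ) {A : Set Plane} (hA : volume A ≠ 0) (hA' : volume A ≠ ∞)
    (f : Plane → ℝ) :
    lam * volume.real A * ∫ z, f z ∂(volume[|A]) = lam * ∫ z in A, f z := by
  rw [ProbabilityTheory.cond, integral_smul_measure, ENNReal.toReal_inv, smul_eq_mul, mul_assoc]
  congr 1
  rw [← mul_assoc, Measure.real, mul_inv_cancel₀ (ENNReal.toReal_ne_zero.2 ⟨hA, hA'⟩), one_mul]

theorem integrable_of_connConst_pos (hC : 0 < connConst g) :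
    Integrable fun z : Plane => g ‖z‖ := by
  by_contra h
  rw [connConst, integral_undef h] at hC
  exact hC.false

/-- Boundary effects only decrease the expected degree, so the lower bound for the mean needs no
boundary analysis. -/
theorem setIntegral_comp_dist_le (hg : ∀ x, g x ∈ Set.Icc (0 : ℝ) 1) (hC : 0 < connConst g)
    (A : Set Plane) (x : Plane) : ∫ z in A, g (dist x z) ≤ connConst g := by
  have hint : Integrable fun z : Plane => g (dist x z) := by
    simpa [dist_eq_norm, norm_sub_rev] using (integrable_of_connConst_pos hC).comp_sub_left x
  refine (setIntegral_le_integral hint (Eventually.of_forall fun z => (hg _).1)).trans_eq ?_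
  rw [connConst, ← integral_sub_left_eq_self (fun z : Plane => g ‖z‖) volume x]
  simp [dist_eq_norm]

/-- A lower bound, from the second moment method, for the probability that there is an isolated
node. -/
theorem le_prob_existsIsolated (hg : ∀ x, g x ∈ Set.Icc (0 : ℝ) 1) (hgm : Measurable g)
    (ν : Measure Plane) [IsProbabilityMeasure ν] (m : ℝ≥0) {D : Set Plane} (hD : MeasurableSet D)
    {μ Q M : ℝ} (hμ : 0 < μ) (hμle : ENNReal.ofReal μ ≤ isolatedMean g ν m D) (hQ : 0 ≤ Q)
    (h₂ : isolatedMean₂ g ν m D ≤ 2 * isolatedMean g ν m D ^ 2 +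
      ENNReal.ofReal Q * isolatedMean g ν m D)
    (hM : 1 + Q ≤ M * μ) :
    ENNReal.ofReal (1 / (2 + M)) ≤
      ((poissonMeasure m).prod (labelLaw ν)) (existsIsolated g D) := by
  have hM0 : 0 ≤ M := by
    by_contra! h
    nlinarith
  set N := isolatedMean g ν m D with hN
  have hNtop : N ≠ ∞ := ne_top_of_le_ne_top ENNReal.coe_ne_top (isolatedMean_le hg ν m D)
  obtain ⟨x, hx, hNx⟩ : ∃ x : ℝ, 0 ≤ x ∧ N = ENNReal.ofReal x :=
    ⟨N.toReal, ENNReal.toReal_nonneg, (ENNReal.ofReal_toReal hNtop).symm⟩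
  have hμx : μ ≤ x := by rwa [hNx, ENNReal.ofReal_le_ofReal_iff hx] at hμle
  have hx0 : 0 < x := hμ.trans_le hμx
  set P := ((poissonMeasure m).prod (labelLaw ν)) (existsIsolated g D)
  -- Since `E N² ≤ (2 + M) x²`, this `t` maximises `2 t x - t² (2 + M) x²`, with value `1 / (2 +
  -- M)`.
  have hmain := two_mul_isolatedMean_le hg hgm ν m hD (ENNReal.ofReal (1 / ((2 + M) * x)))
  have hPtop : P ≠ ∞ := measure_ne_top _ _
  rw [← hN] at hmain
  have hbound : 2 * ENNReal.ofReal (1 / ((2 + M) * x)) * N ≤ P +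
      ENNReal.ofReal (1 / ((2 + M) * x)) ^ 2 * (N + (2 * N ^ 2 + ENNReal.ofReal Q * N)) :=
    hmain.trans (by gcongr)
  rw [hNx, ← ENNReal.ofReal_toReal hPtop, ← ENNReal.ofReal_pow hx, ← ENNReal.ofReal_mul hQ,
    show (2 : ℝ≥0∞) = ENNReal.ofReal 2 by simp, ← ENNReal.ofReal_mul (by positivity),
    ← ENNReal.ofReal_mul (by positivity), ← ENNReal.ofReal_mul (by positivity),
    ← ENNReal.ofReal_pow (by positivity), ← ENNReal.ofReal_add (by positivity) (by positivity),
    ← ENNReal.ofReal_add (by positivity) (by positivity), ← ENNReal.ofReal_mul (by positivity),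
    ← ENNReal.ofReal_add (by positivity) (by positivity),
    ENNReal.ofReal_le_ofReal_iff (by positivity)] at hbound
  refine ENNReal.ofReal_le_of_le_toReal ?_
  have h1 : 2 * (1 / ((2 + M) * x)) * x = 2 * (1 / (2 + M)) := by field_simp
  have h2 : (1 / ((2 + M) * x)) ^ 2 * (x + (2 * x ^ 2 + Q * x)) ≤ 1 / (2 + M) := by
    have h3 : x + (2 * x ^ 2 + Q * x) ≤ (2 + M) * x ^ 2 := by
      nlinarith [mul_le_mul_of_nonneg_right hM hx, mul_le_mul_of_nonneg_left hμx (mul_nonneg hM0 hx)]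
    calc (1 / ((2 + M) * x)) ^ 2 * (x + (2 * x ^ 2 + Q * x))
        ≤ (1 / ((2 + M) * x)) ^ 2 * ((2 + M) * x ^ 2) := by gcongr
      _ = 1 / (2 + M) := by field_simp
  linarith

theorem prob_connected_le (ν : Measure Plane) [IsProbabilityMeasure ν] (m : ℝ≥0) (hgm : Measurable g)
    {D : Set Plane} (hD : MeasurableSet D) {p : ℝ} (hp : 0 ≤ p)
    (hiso : ENNReal.ofReal p ≤ ((poissonMeasure m).prod (labelLaw ν)) (existsIsolated g D)) :
    ((poissonMeasure m).prod (labelLaw ν)) {ω : Sample | (graph g ω).Connected} ≤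
      ENNReal.ofReal (1 - p + m * Real.exp (-m)) := by
  refine (measure_mono (connected_subset g D)).trans ((measure_union_le _ _).trans ?_)
  rw [prob_compl_eq_one_sub (measurableSet_existsIsolated hgm hD), Measure.prod_prod, measure_univ,
    mul_one, poissonMeasure_singleton]
  have h1 : 1 - ((poissonMeasure m).prod (labelLaw ν)) (existsIsolated g D) ≤
      ENNReal.ofReal (1 - p) := by
    rw [ENNReal.ofReal_sub _ hp, ENNReal.ofReal_one]
    gcongr
  have hp1 : p ≤ 1 := by
    have := hiso.trans prob_le_one
    rwa [ENNReal.ofReal_le_one] at this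
  rw [ENNReal.ofReal_add (sub_nonneg.2 hp1) (by positivity)]
  refine add_le_add h1 (ENNReal.ofReal_le_ofReal (le_of_eq ?_))
  simp [mul_comm]

/-- A non-asymptotic bound for the probability of connectivity on a square of side `s` at node
density `lam`; `r` and `δ` are as in `exists_private_disc`, and `R` separates near and far pairs. -/
theorem sampleLaw_connected_le (hg : ∀ x, g x ∈ Set.Icc (0 : ℝ) 1) (hanti : Antitone g)
    (hC : 0 < connConst g) {r δ : ℝ} (hr : 0 < r)
    (hdisc : ∀ x y : Plane, g (dist x y) = 1 ∨ ∃ w : Plane,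
      Metric.closedBall w (r / 4) ⊆ Metric.closedBall y r ∧
        ∀ z ∈ Metric.closedBall w (r / 4), δ ≤ g (dist y z) * (1 - g (dist x z)))
    {lam s R M : ℝ} (hlam : 0 < lam) (hs : 4 * r ≤ s) (hR : 0 ≤ R)
    (hη : 2 * (lam * connConst g) * g (R / 2) ≤ Real.log 2)
    (hM : 1 + lam * (discArea * R ^ 2) * Real.exp (-(lam * (δ * (discArea * (r / 4) ^ 2)))) ≤
      M * (lam * s ^ 2 * Real.exp (-(lam * connConst g)) / 4)) :
    sampleLaw lam (square s) {ω | (graph g ω).Connected} ≤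
      ENNReal.ofReal (1 - 1 / (2 + M) + lam * s ^ 2 * Real.exp (-(lam * s ^ 2))) := by
  have hgm := hanti.measurable
  have hs0 : 0 < s := by linarith
  have hvol := volume_square hs0.le
  have hvol0 : volume (square s) ≠ 0 := by rw [hvol]; simpa using hs0.ne'
  have hvolt : volume (square s) ≠ ∞ := by rw [hvol]; exact ENNReal.ofReal_ne_top
  have hreal : volume.real (square s) = s ^ 2 := by
    rw [Measure.real, hvol, ENNReal.toReal_ofReal (by positivity)]
  have : IsProbabilityMeasure ((volume : Measure Plane)[|square s]) :=
    cond_isProbabilityMeasure_of_finite hvol0 hvolt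
  set ν : Measure Plane := volume[|square s] with hν
  set m : ℝ≥0 := (lam * volume.real (square s)).toNNReal with hm
  have hmcoe : (m : ℝ) = lam * volume.real (square s) :=
    Real.coe_toNNReal _ (by rw [hreal]; positivity)
  have hmcoe' : (m : ℝ) = lam * s ^ 2 := by rw [hmcoe, hreal]
  have hmint : ∀ f : Plane → ℝ, m * ∫ z, f z ∂ν = lam * ∫ z in square s, f z := fun f => by
    rw [hmcoe]; exact mul_integral_cond lam hvol0 hvolt f
  have hD : MeasurableSet (square (s - 2 * r)) := measurableSet_square _
  have hγ : ∀ x, m * ∫ z, g (dist x z) ∂ν ≤ lam * connConst g := fun x => by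
    rw [hmint]
    exact mul_le_mul_of_nonneg_left (setIntegral_comp_dist_le hg hC _ x) hlam.le
  have hνapply : ∀ S : Set Plane, MeasurableSet S →
      ν S = ENNReal.ofReal (s ^ 2)⁻¹ * volume (square s ∩ S) := fun S hS => by
    rw [hν, cond_apply (measurableSet_square s), hvol, ENNReal.ofReal_inv_of_pos (by positivity)]
  -- `4 r ≤ s` gives `s - 2 r ≥ s / 2`. The margin `r` keeps the private discs inside the domain.
  have hνD : ENNReal.ofReal (1 / 4) ≤ ν (square (s - 2 * r)) := by
    rw [hνapply _ hD, Set.inter_eq_right.2 (square_mono (by linarith)),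
      volume_square (by linarith), ← ENNReal.ofReal_mul (by positivity)]
    refine ENNReal.ofReal_le_ofReal ?_
    rw [inv_mul_eq_div, div_le_div_iff₀ (by norm_num) (by positivity)]
    nlinarith
  have hμ : ENNReal.ofReal (lam * s ^ 2 * Real.exp (-(lam * connConst g)) / 4) ≤
      isolatedMean g ν m (square (s - 2 * r)) := by
    refine le_trans ?_ (le_isolatedMean hg hgm ν m _ hγ)
    rw [div_eq_mul_one_div, ENNReal.ofReal_mul (by positivity), hmcoe']
    gcongr
  refine (prob_connected_le ν m hgm hD (p := 1 / (2 + M)) ?_ ?_).trans_eq ?_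
  · have : 0 ≤ M := by
      by_contra! h
      have h1 : M * (lam * s ^ 2 * Real.exp (-(lam * connConst g)) / 4) ≤ 0 :=
        mul_nonpos_of_nonpos_of_nonneg h.le (by positivity)
      have h2 : 0 ≤ lam * (discArea * R ^ 2) *
          Real.exp (-(lam * (δ * (discArea * (r / 4) ^ 2)))) := by
        have := discArea_nonneg; positivity
      linarith
    positivity
  · refine le_prob_existsIsolated hg hgm ν m hD (by positivity) hμ
      (by have := discArea_nonneg; positivity) ?_ hM
    have hfar : ∀ x y, R ≤ dist x y →
        m * ∫ z, g (dist x z) * g (dist y z) ∂ν ≤ Real.log 2 := by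
      intro x y hxy
      have h := mul_le_mul_of_nonneg_left (integral_comp_dist_mul_le hg hanti ν hxy) m.coe_nonneg
      have h1 := mul_le_mul_of_nonneg_left (add_le_add (hγ x) (hγ y)) (hg (R / 2)).1
      linarith
    have hnear : ∀ x ∈ square (s - 2 * r), ∀ y ∈ square (s - 2 * r), g (dist x y) = 1 ∨
        lam * (δ * (discArea * (r / 4) ^ 2)) ≤
          m * ∫ z, g (dist y z) * (1 - g (dist x z)) ∂ν := by
      intro x _ y hy
      rcases hdisc x y with h | ⟨w, hw, hwδ⟩
      · exact Or.inl h
      right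
      rw [hmint]
      refine mul_le_mul_of_nonneg_left ?_ hlam.le
      have : IsFiniteMeasure (volume.restrict (square s) : Measure Plane) :=
        isFiniteMeasure_restrict.2 hvolt
      have hint : IntegrableOn (fun z => g (dist y z) * (1 - g (dist x z))) (square s) := by
        refine ((integrable_comp_dist hg hgm (volume.restrict (square s)) y).sub
          (integrable_comp_dist_mul hg hgm (volume.restrict (square s)) x y)).congr
          (Eventually.of_forall fun z => ?_)
        simp only [Pi.sub_apply]
        ring
      have hsub := hw.trans (closedBall_subset_square hy)
      have hball := Metric.isClosed_closedBall.measurableSet (s := Metric.closedBall w (r / 4))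
      rw [← volume_real_closedBall_plane w (by positivity)]
      calc δ * volume.real (Metric.closedBall w (r / 4))
          = ∫ z in Metric.closedBall w (r / 4), δ := by
            rw [setIntegral_const, smul_eq_mul, mul_comm]
        _ ≤ ∫ z in Metric.closedBall w (r / 4), g (dist y z) * (1 - g (dist x z)) :=
            setIntegral_mono_on (integrableOn_const measure_closedBall_lt_top.ne)
              (hint.mono_set hsub) hball hwδ
        _ ≤ ∫ z in square s, g (dist y z) * (1 - g (dist x z)) :=
            setIntegral_mono_set hint (Eventually.of_forall fun z =>
              mul_nonneg (hg _).1 (sub_nonneg.2 (hg _).2)) hsub.eventuallyLE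
    have hV : ∀ x, m * ν (Metric.ball x R) ≤ ENNReal.ofReal (lam * (discArea * R ^ 2)) := by
      intro x
      rw [hνapply _ Metric.isOpen_ball.measurableSet, ← ENNReal.ofReal_coe_nnreal, hmcoe',
        ← mul_assoc, ← ENNReal.ofReal_mul (by positivity), ENNReal.ofReal_mul hlam.le,
        ← volume_ball_plane x hR, mul_inv_cancel_right₀ (by positivity)]
      gcongr
      exact Set.inter_subset_right
    have h := isolatedMean₂_le hg hgm ν m hD hfar hnear hV
    rwa [Real.exp_log two_pos, ENNReal.ofReal_ofNat] at h
  · rw [hmcoe']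

end

end RandomConnection

/-! ### Asymptotics as `ρ → ∞`. -/

namespace RandomConnection

theorem exists_pos_of_connConst_pos {g : ℝ → ℝ} (hg : ∀ x, g x ∈ Set.Icc (0 : ℝ) 1)
    (hC : 0 < connConst g) : ∃ r, 0 < r ∧ 0 < g r := by
  by_contra! h
  refine hC.ne' (integral_eq_zero_of_ae ?_)
  have hne : ∀ᵐ z : Plane, z ≠ 0 := by simp [ae_iff]
  filter_upwards [hne] with z hz
  exact le_antisymm (h _ (norm_pos_iff.2 hz)) (hg _).1

/-- This is the form in which decay enters: with `R = log ρ` and `u ≤ 2 log ρ`, it makes `u * g (R /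
2)` small. -/
theorem isLittleO_inv_of_decay {g : ℝ → ℝ}
    (hdecay : g =o[atTop] fun x : ℝ => 1 / (x ^ 2 * Real.log x ^ 2)) :
    g =o[atTop] fun x : ℝ => x⁻¹ := by
  refine hdecay.trans_isBigO (IsBigO.of_bound 1 ?_)
  filter_upwards [eventually_ge_atTop 1, Real.tendsto_log_atTop.eventually_ge_atTop 1] with x hx hl
  have hl2 : 1 ≤ Real.log x ^ 2 := one_le_pow₀ hl
  rw [one_mul, one_div, norm_inv, norm_inv, Real.norm_of_nonneg (by positivity),
    Real.norm_of_nonneg (by positivity)]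
  gcongr
  nlinarith

theorem eventually_mul_cube_le_exp (K : ℝ) {κ : ℝ} (hκ : 0 < κ) :
    ∀ᶠ x : ℝ in atTop, K * x ^ 3 ≤ Real.exp (κ * x) := by
  have h := (isLittleO_pow_exp_pos_mul_atTop 3 hκ).def (c := (|K| + 1)⁻¹) (by positivity)
  filter_upwards [h, eventually_ge_atTop 0] with x hx hx0
  rw [Real.norm_of_nonneg (by positivity), Real.norm_of_nonneg (Real.exp_pos _).le,
    inv_mul_eq_div, le_div_iff₀ (by positivity)] at hx
  nlinarith [le_abs_self K, pow_nonneg hx0 3]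

theorem tendsto_atTop_of_antitone {g : ℝ → ℝ} {b : ℝ → ℝ}
    (hg : ∀ x, g x ∈ Set.Icc (0 : ℝ) 1) (hanti : Antitone g)
    (hdecay : g =o[atTop] fun x : ℝ => x⁻¹) (hC : 0 < connConst g)
    (hb : ∀ᶠ ρ in atTop, 0 < Real.log ρ + b ρ)
    (hconn : Tendsto (fun ρ : ℝ => probConnected g (b ρ) ρ) atTop (𝓝 1)) :
    Tendsto b atTop atTop := by
  refine tendsto_atTop.2 fun B => ?_
  by_contra hB
  have hfreq : ∃ᶠ ρ in atTop, b ρ < B := by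
    rw [Filter.not_eventually] at hB
    exact hB.mono fun ρ h => not_le.1 h
  have hlim : Tendsto g atTop (𝓝 0) := hdecay.isBigO.trans_tendsto tendsto_inv_atTop_zero
  obtain ⟨r, hr, hgr⟩ := exists_pos_of_connConst_pos hg hC
  obtain ⟨δ, hδ, hdisc⟩ := exists_private_disc hg hanti hlim hr hgr
  set C := connConst g with hCdef
  have hv := discArea_pos
  -- The cap at `1` makes `1 - κ` nonnegative, so that `u ≤ l + B` can be multiplied by it.
  set κ : ℝ := min (δ * (discArea * (r / 4) ^ 2) / C) 1 with hκ
  have hκ0 : 0 < κ := lt_min (by positivity) one_pos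
  set M : ℝ := 4 * (Real.exp B + 1) with hM
  have hM0 : 0 < M := by positivity
  have hlog := Real.tendsto_log_atTop
  have hlog2 : 0 < Real.log 2 := Real.log_pos one_lt_two
  have hsmall : ∀ᶠ ρ : ℝ in atTop, ‖g (Real.log ρ / 2)‖ ≤ Real.log 2 / 8 * ‖(Real.log ρ / 2)⁻¹‖ :=
    (hlog.atTop_div_const two_pos).eventually (hdecay.def (by positivity))
  have hcube := hlog.eventually
    (eventually_mul_cube_le_exp (2 * discArea / C * Real.exp |B|) hκ0)
  -- With `u ≤ 2 log ρ` this yields `16 r² ≤ C ρ / u`, that is `4 r ≤ s`.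
  have hside : ∀ᶠ ρ : ℝ in atTop, ‖Real.log ρ‖ ≤ C / (32 * r ^ 2) * ‖ρ‖ :=
    Real.isLittleO_log_id_atTop.def (by positivity)
  -- The one-node event may use up half of the gap `1 / (2 + M)`.
  have hone : ∀ᶠ ρ : ℝ in atTop, ρ ^ 1 * Real.exp (-ρ) < 1 / (2 * (2 + M)) :=
    (Real.tendsto_pow_mul_exp_neg_atTop_nhds_zero 1).eventually (gt_mem_nhds (by positivity))
  have hbound : ∀ᶠ ρ in atTop, b ρ < B →
      probConnected g (b ρ) ρ ≤ ENNReal.ofReal (1 - 1 / (2 * (2 + M))) := by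
    filter_upwards [hb, hsmall, hcube, hside, hone, eventually_gt_atTop 0,
      hlog.eventually_ge_atTop 1, hlog.eventually_ge_atTop B]
      with ρ hbρ hsmall hcube hside hone hρ hl1 hlB hbB
    set l := Real.log ρ with hl
    set u := l + b ρ with hu
    have hu2 : u ≤ 2 * l := by linarith
    have hl0 : 0 < l := by linarith
    have hdens : nodeDensity g (b ρ) ρ = u / C := rfl
    have hdensC : nodeDensity g (b ρ) ρ * C = u := by rw [hdens]; field_simp
    have hs2 : (1 / connRadius g (b ρ) ρ) ^ 2 = C * ρ / u := by
      rw [connRadius, div_pow, Real.sq_sqrt (by positivity)]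
      simp only [one_pow, one_div, inv_div]
      rfl
    have hmean : nodeDensity g (b ρ) ρ * (1 / connRadius g (b ρ) ρ) ^ 2 = ρ := by
      rw [hs2, hdens]; field_simp
    have hgood := sampleLaw_connected_le hg hanti hC hr hdisc
      (lam := nodeDensity g (b ρ) ρ) (s := 1 / connRadius g (b ρ) ρ) (R := l) (M := M)
      (by rw [hdens]; positivity) ?_ hl0.le ?_ ?_
    · rw [hmean] at hgood
      refine hgood.trans (ENNReal.ofReal_le_ofReal ?_)
      rw [pow_one] at hone
      have : 1 / (2 + M) = 1 / (2 * (2 + M)) + 1 / (2 * (2 + M)) := by field_simp; norm_num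
      linarith
    · refine (pow_le_pow_iff_left₀ (by positivity) (by unfold connRadius; positivity)
        two_ne_zero).1 ?_
      rw [hs2, le_div_iff₀ hbρ]
      rw [Real.norm_of_nonneg hl0.le, Real.norm_of_nonneg hρ.le, div_mul_eq_mul_div,
        le_div_iff₀ (by positivity)] at hside
      nlinarith [mul_le_mul_of_nonneg_left hu2 (sq_nonneg r)]
    · rw [hdensC]
      rw [Real.norm_of_nonneg (hg _).1, Real.norm_of_nonneg (by positivity)] at hsmall
      calc 2 * u * g (l / 2) ≤ 2 * (2 * l) * (Real.log 2 / 8 * (l / 2)⁻¹) := by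
            have := (hg (l / 2)).1
            gcongr
        _ = Real.log 2 := by field_simp; norm_num
    · rw [hmean, hdensC]
      have hexpρ : ρ * Real.exp (-u) = Real.exp (l - u) := by
        rw [sub_eq_add_neg, Real.exp_add, hl, Real.exp_log hρ]
      have hfirst : 1 ≤ Real.exp B * Real.exp (l - u) := by
        rw [← Real.exp_add]
        exact Real.one_le_exp (by linarith)
      have hdecay : Real.exp (-(nodeDensity g (b ρ) ρ * (δ * (discArea * (r / 4) ^ 2)))) ≤
          Real.exp (-(u * κ)) := by
        have : u * κ ≤ u * (δ * (discArea * (r / 4) ^ 2) / C) :=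
          mul_le_mul_of_nonneg_left (min_le_left _ _) hbρ.le
        refine Real.exp_le_exp.2 (neg_le_neg (this.trans_eq ?_))
        rw [hdens]; ring
      -- As `b` may be very negative, `u` need not grow and `exp (-(u * κ))` need not be small; the
      -- mean, of order `exp (l - u)`, then compensates.
      have hexponent : κ * l - |B| ≤ l - u + u * κ := by
        have h1 : u * (1 - κ) ≤ (l + B) * (1 - κ) :=
          mul_le_mul_of_nonneg_right (by linarith) (sub_nonneg.2 (min_le_right _ _))
        have h2 : B * (1 - κ) ≤ |B| :=
          (mul_le_mul_of_nonneg_right (le_abs_self B) (sub_nonneg.2 (min_le_right _ _))).trans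
            (mul_le_of_le_one_right (abs_nonneg B) (by linarith))
        linarith
      have hsecond : nodeDensity g (b ρ) ρ * (discArea * l ^ 2) *
          Real.exp (-(nodeDensity g (b ρ) ρ * (δ * (discArea * (r / 4) ^ 2)))) ≤
          Real.exp (l - u) := by
        calc nodeDensity g (b ρ) ρ * (discArea * l ^ 2) *
              Real.exp (-(nodeDensity g (b ρ) ρ * (δ * (discArea * (r / 4) ^ 2))))
            ≤ (2 * l / C) * (discArea * l ^ 2) * Real.exp (-(u * κ)) := by
              rw [hdens] at hdecay ⊢
              gcongr
          _ = (2 * discArea / C * Real.exp |B| * l ^ 3) * Real.exp (-|B| - u * κ) := by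
              rw [sub_eq_add_neg, Real.exp_add, Real.exp_neg |B|]
              field_simp
          _ ≤ Real.exp (κ * l) * Real.exp (-|B| - u * κ) := by gcongr
          _ ≤ Real.exp (l - u) := by
              rw [← Real.exp_add]
              exact Real.exp_le_exp.2 (by linarith)
      calc _ ≤ Real.exp B * Real.exp (l - u) + Real.exp (l - u) := add_le_add hfirst hsecond
        _ = M * (ρ * Real.exp (-u) / 4) := by rw [hexpρ, hM]; ring
  have hlt : ENNReal.ofReal (1 - 1 / (2 * (2 + M))) < 1 := by
    rw [ENNReal.ofReal_lt_one]
    have : 0 < 1 / (2 * (2 + M)) := by positivity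
    linarith
  obtain ⟨ρ, hρ⟩ := (hfreq.and_eventually
    (hbound.and (hconn.eventually (lt_mem_nhds hlt)))).exists
  exact absurd (hρ.2.1 hρ.1) (not_le.2 hρ.2.2)

end RandomConnection

theorem corollary1 (g : ℝ → ℝ) (b : ℝ → ℝ)
    (hg : ∀ x, 0 ≤ x → g x ∈ Set.Icc (0 : ℝ) 1)
    (hmono : AntitoneOn g (Set.Ici 0))
    (hdecay : g =o[atTop] fun x : ℝ => 1 / (x ^ 2 * Real.log x ^ 2))
    (hC : 0 < RandomConnection.connConst g)
    (hb : ∀ᶠ ρ in atTop, 0 < Real.log ρ + b ρ)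
    (hconn : Tendsto (fun ρ : ℝ => RandomConnection.probConnected g (b ρ) ρ) atTop (𝓝 1)) :
    Tendsto b atTop atTop := by
  -- Extending `g` by `g 0` to negative arguments makes it monotone on all of `ℝ`, hence measurable;
  -- the model evaluates it only at norms and distances.
  set f : ℝ → ℝ := fun x => g (max x 0) with hf
  have hfg : ∀ x, 0 ≤ x → f x = g x := fun x hx => by rw [hf]; simp only [max_eq_left hx]
  have hconst : RandomConnection.connConst f = RandomConnection.connConst g := by
    unfold RandomConnection.connConst
    exact integral_congr_ae (Eventually.of_forall fun z => hfg _ (norm_nonneg z))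
  have hgraph : RandomConnection.graph f = RandomConnection.graph g := by
    funext ω
    ext i j
    simp only [RandomConnection.graph, hfg _ dist_nonneg]
  have hprob : ∀ β ρ : ℝ, RandomConnection.probConnected f β ρ =
      RandomConnection.probConnected g β ρ := fun β ρ => by
    simp only [RandomConnection.probConnected, RandomConnection.nodeDensity,
      RandomConnection.connRadius, hconst, hgraph]
  refine RandomConnection.tendsto_atTop_of_antitone (g := f) (fun x => hg _ (le_max_right _ _))
    (fun x y hxy => hmono (Set.mem_Ici.2 (le_max_right x 0)) (Set.mem_Ici.2 (le_max_right y 0))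
      (max_le_max_right 0 hxy))
    ?_ (hconst ▸ hC) hb (by simpa only [hprob] using hconn)
  refine (RandomConnection.isLittleO_inv_of_decay hdecay).congr' ?_ EventuallyEq.rfl
  filter_upwards [eventually_ge_atTop 0] with x hx using (hfg x hx).symm
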